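/- Let $k\ge 1$, let $\mathbb D$ be the open unit disc of $\mathbb C$ and $\overline{\mathbb D}$ the closed one. Let $A^+(\mathbb T^k)$ be the algebra (under pointwise operations) of the functions $f\colon \overline{\mathbb D}^k\to\mathbb C$ that can be written as $f(z)=\sum_{n\in\mathbb N_0^k} a(n)\, z_1^{n_1}\cdots z_k^{n_k}$ with $\|f\|_{A^+(\mathbb T^k)}=\sum_{n}|a(n)|<\infty$. Assume that the map $\varphi\colon \mathbb D^k\to\overline{\mathbb D}^k$ induces a bounded composition operator $C_\varphi\colon A^+(\mathbb T^k)\to A^+(\mathbb T^k)$; that is, for every $f\in A^+(\mathbb T^k)$ the function $f\circ\varphi$ on $\mathbb D^k$ extends to a (necessarily unique) element $C_\varphi f$ of $A^+(\mathbb T^k)$, and there is a constant $C$ with $\|C_\varphi f\|_{A^+(\mathbb T^k)}\le C\|f\|_{A^+(\mathbb T^k)}$ for all $f$. Then $C_\varphi$ is an automorphism of the algebra $A^+(\mathbb T^k)$ if and only if there are a permutation $\sigma$ of $\{1,\dots,k\}$ and complex numbers $\varepsilon_1,\dots,\varepsilon_k$ of modulus $1$ such that $\varphi(z)=(\varepsilon_1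 z_{\sigma(1)},\dots,\varepsilon_k z_{\sigma(k)})$ for all $z\in\mathbb D^k$. -/

import Mathlib

/-- The open unit polydisc `𝔻^k`. -/
def polydisc (k : ℕ) : Set (Fin k → ℂ) := {z | ∀ i, ‖z i‖ < 1}

/-- The closed unit polydisc. -/
def closedPolydisc (k : ℕ) : Set (Fin k → ℂ) := {z | ∀ i, ‖z i‖ ≤ 1}

namespace WienerPlus

/-- The inclusion of the open polydisc in the closed one. -/
def incl {k : ℕ} (z : polydisc k) : closedPolydisc k := ⟨z.1, fun i => (z.2 i).le⟩

/-- The monomial `z₁^{n₁} ⋯ z_k^{n_k}`. -/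
def monomial {k : ℕ} (n : Fin k → ℕ) (z : closedPolydisc k) : ℂ := ∏ i, z.1 i ^ n i

/-- `f(z) = ∑ a(n) z^n` on the closed polydisc, with `∑ |a(n)| < ∞`. -/
def Represents {k : ℕ} (a : (Fin k → ℕ) → ℂ) (f : closedPolydisc k → ℂ) : Prop :=
  Summable (fun n => ‖a n‖) ∧ ∀ z, HasSum (fun n => a n * monomial n z) (f z)

theorem norm_monomial_le {k : ℕ} (n : Fin k → ℕ) (z : closedPolydisc k) :
    ‖monomial n z‖ ≤ 1 := by
  rw [monomial, norm_prod]
  refine Finset.prod_le_one (fun i _ => norm_nonneg _) (fun i _ => ?_)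
  rw [norm_pow]
  exact pow_le_one₀ (norm_nonneg _) (z.2 i)

theorem norm_term_le {k : ℕ} (a : (Fin k → ℕ) → ℂ) (n : Fin k → ℕ) (z : closedPolydisc k) :
    ‖a n * monomial n z‖ ≤ ‖a n‖ := by
  rw [norm_mul]
  exact mul_le_of_le_one_right (norm_nonneg _) (norm_monomial_le n z)

theorem monomial_add {k : ℕ} (n m : Fin k → ℕ) (z : closedPolydisc k) :
    monomial (n + m) z = monomial n z * monomial m z := by
  simp [monomial, pow_add, Finset.prod_mul_distrib]

theorem continuous_monomial {k : ℕ} (n : Fin k → ℕ) :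
    Continuous (monomial n : closedPolydisc k → ℂ) := by
  refine continuous_finsetProd _ fun i _ => ?_
  exact ((continuous_apply i).comp continuous_subtype_val).pow _

theorem Represents.add {k : ℕ} {a b : (Fin k → ℕ) → ℂ} {f g : closedPolydisc k → ℂ}
    (hf : Represents a f) (hg : Represents b g) : Represents (a + b) (f + g) := by
  refine ⟨Summable.of_nonneg_of_le (fun n => norm_nonneg _) (fun n => norm_add_le _ _)
    (hf.1.add hg.1), fun z => ?_⟩
  simpa [add_mul] using (hf.2 z).add (hg.2 z)

theorem represents_const {k : ℕ} (c : ℂ) :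
    Represents (fun n : Fin k → ℕ => if n = 0 then c else 0) (fun _ => c) := by
  constructor
  · refine summable_of_ne_finset_zero (s := {0}) fun n hn => ?_
    simp [Finset.notMem_singleton.1 hn]
  · intro z
    have h := hasSum_single (f := fun n : Fin k → ℕ =>
      (if n = 0 then c else 0) * monomial n z) 0 (fun n hn => by simp [hn])
    simpa [monomial] using h

theorem summable_norm_fiber {P Q : Type} (g : Q → P) (u : Q → ℂ)
    (hu : Summable (fun q => ‖u q‖)) : Summable (fun p => ‖∑' q : g ⁻¹' {p}, u q‖) :=
  Summable.of_nonneg_of_le (fun _ => norm_nonneg _)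
    (fun p => norm_tsum_le_tsum_norm (f := fun q : g ⁻¹' {p} => u q)
      (hu.comp_injective Subtype.val_injective)) (hu.hasSum.tsum_fiberwise g).summable

theorem Represents.mul {k : ℕ} {a b : (Fin k → ℕ) → ℂ} {f g : closedPolydisc k → ℂ}
    (hf : Represents a f) (hg : Represents b g) :
    Represents (fun p => ∑' q : (fun q : (Fin k → ℕ) × (Fin k → ℕ) => q.1 + q.2) ⁻¹' {p},
      a q.1.1 * b q.1.2) (f * g) := by
  have hs : Summable (fun q : (Fin k → ℕ) × (Fin k → ℕ) => ‖a q.1 * b q.2‖) :=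
    Summable.mul_norm hf.1 hg.1
  refine ⟨summable_norm_fiber _ (fun q : (Fin k → ℕ) × (Fin k → ℕ) => a q.1 * b q.2) hs,
    fun z => ?_⟩
  have hsum : Summable (fun q : (Fin k → ℕ) × (Fin k → ℕ) =>
      (a q.1 * monomial q.1 z) * (b q.2 * monomial q.2 z)) := by
    refine Summable.of_norm (Summable.mul_norm (f := fun n => a n * monomial n z)
      (g := fun n => b n * monomial n z) ?_ ?_)
    · exact Summable.of_nonneg_of_le (fun _ => norm_nonneg _)
        (fun n => norm_term_le a n z) hf.1
    · exact Summable.of_nonneg_of_le (fun _ => norm_nonneg _)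
        (fun n => norm_term_le b n z) hg.1
  have h2 := ((hf.2 z).mul (hg.2 z) hsum).tsum_fiberwise
    (fun q : (Fin k → ℕ) × (Fin k → ℕ) => q.1 + q.2)
  have h3 : (fun p => (∑' q : (fun q : (Fin k → ℕ) × (Fin k → ℕ) => q.1 + q.2) ⁻¹' {p},
      a q.1.1 * b q.1.2) * monomial p z) = fun p =>
      ∑' q : (fun q : (Fin k → ℕ) × (Fin k → ℕ) => q.1 + q.2) ⁻¹' {p},
        (a q.1.1 * monomial q.1.1 z) * (b q.1.2 * monomial q.1.2 z) := by
    funext p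
    rw [← tsum_mul_right]
    refine tsum_congr fun q => ?_
    have hq : q.1.1 + q.1.2 = p := q.2
    have hm : monomial p z = monomial q.1.1 z * monomial q.1.2 z := by
      rw [← monomial_add, hq]
    rw [hm]
    ring
  rw [h3]
  exact h2

/-- The coefficients of an absolutely convergent power series are determined by its values on the
closed polydisc. -/
theorem Represents.unique {k : ℕ} {a b : (Fin k → ℕ) → ℂ} {f : closedPolydisc k → ℂ}
    (ha : Represents a f) (hb : Represents b f) : a = b := by
  let ι : (Fin k → ℕ) → (Fin k → ℤ) := fun n i => n i
  have hι : Function.Injective ι := fun n m h => by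
    funext i
    exact Int.ofNat_injective (congrFun h i)
  let E : (Fin k → ℕ) → C(UnitAddTorus (Fin k), ℂ) := fun n => UnitAddTorus.mFourier (ι n)
  have hc : Summable (fun n => ‖a n - b n‖) :=
    Summable.of_nonneg_of_le (fun n => norm_nonneg _) (fun n => norm_sub_le _ _) (ha.1.add hb.1)
  have hS : Summable (fun n => (a n - b n) • E n) := by
    refine Summable.of_norm ?_
    simpa [norm_smul, E, UnitAddTorus.mFourier_norm] using hc
  have h0 : HasSum (fun n => (a n - b n) • E n) 0 := by
    convert hS.hasSum
    ext x
    have ht := ContinuousMap.tsum_apply hS x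
    rw [← ht]
    let z : closedPolydisc k := ⟨fun i => (AddCircle.toCircle (x i) : ℂ),
      fun i => (Circle.norm_coe _).le⟩
    have h := (ha.2 z).sub (hb.2 z)
    rw [sub_self] at h
    refine h.tsum_eq.symm.trans (tsum_congr fun n => ?_)
    simp [E, ι, z, monomial, UnitAddTorus.mFourier, fourier_apply, sub_mul,
      AddCircle.toCircle_nsmul]
  funext m
  let _ : MeasureTheory.MeasureSpace UnitAddCircle := ⟨AddCircle.haarAddCircle⟩
  have : MeasureTheory.IsProbabilityMeasure
      (MeasureTheory.volume : MeasureTheory.Measure UnitAddCircle) :=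
    inferInstanceAs (MeasureTheory.IsProbabilityMeasure AddCircle.haarAddCircle)
  let L : C(UnitAddTorus (Fin k), ℂ) →L[ℂ] ℂ :=
    (innerSL ℂ (UnitAddTorus.mFourierLp 2 (ι m))).comp 
      (ContinuousMap.toLp (E := ℂ) 2 MeasureTheory.volume ℂ)
  have hL : ∀ n, L (E n) = if m = n then 1 else 0 := fun n => by
    have ho := orthonormal_iff_ite.1 (UnitAddTorus.orthonormal_mFourier (d := Fin k)) (ι m) (ι n)
    simp only [hι.eq_iff] at ho
    exact ho
  have h2 := ContinuousLinearMap.hasSum L h0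
  simp only [map_smul, hL, map_zero] at h2
  have h3 := hasSum_single m (f := fun n => (a n - b n) • (if m = n then (1 : ℂ) else 0))
    (fun n hn => by simp [Ne.symm hn])
  have h4 := h3.unique h2
  simpa [sub_eq_zero] using h4

/-- The functions of the Wiener algebra are continuous on the closed polydisc. -/
theorem Represents.continuous {k : ℕ} {a : (Fin k → ℕ) → ℂ} {f : closedPolydisc k → ℂ}
    (ha : Represents a f) : Continuous f := by
  have : f = fun z => ∑' n, a n * monomial n z := funext fun z => (ha.2 z).tsum_eq.symm
  rw [this]
  exact continuous_tsum (fun n => continuous_const.mul (continuous_monomial n)) ha.1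
    (fun n z => norm_term_le a n z)

theorem denseRange_incl (k : ℕ) : DenseRange (incl : polydisc k → closedPolydisc k) := by
  intro z
  have hmem : ∀ j : ℕ, (fun i => ((1 - 1 / ((j : ℝ) + 1) : ℝ) : ℂ) * z.1 i) ∈ polydisc k := by
    intro j i
    have h1 : 0 < 1 / ((j : ℝ) + 1) := by positivity
    have h2 : 1 / ((j : ℝ) + 1) ≤ 1 := by
      rw [div_le_one (by positivity)]
      linarith [(Nat.cast_nonneg j : (0 : ℝ) ≤ j)]
    have h3 := z.2 i
    rw [norm_mul, Complex.norm_real, Real.norm_of_nonneg (by linarith)]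
    nlinarith [norm_nonneg (z.1 i)]
  refine mem_closure_of_tendsto (f := fun j : ℕ => incl ⟨_, hmem j⟩) (b := Filter.atTop) ?_
    (Filter.Eventually.of_forall fun j => Set.mem_range_self _)
  rw [tendsto_subtype_rng, tendsto_pi_nhds]
  intro i
  have h := (tendsto_one_div_add_atTop_nhds_zero_nat (𝕜 := ℝ)).const_sub 1
  have h' := ((Complex.continuous_ofReal.tendsto _).comp h).mul_const (z.1 i)
  simpa [incl, Function.comp_def] using h'

end WienerPlus

open WienerPlus in
/-- The Wiener algebra `A⁺(𝕋^k)`: the algebra, under pointwise operations, of the functions on the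
closed polydisc that are sums of an absolutely convergent power series. -/
def WienerPlus (k : ℕ) : Subalgebra ℂ (closedPolydisc k → ℂ) where
  carrier := {f | ∃ a, Represents a f}
  mul_mem' := fun ⟨_, ha⟩ ⟨_, hb⟩ => ⟨_, ha.mul hb⟩
  add_mem' := fun ⟨_, ha⟩ ⟨_, hb⟩ => ⟨_, ha.add hb⟩
  algebraMap_mem' := fun c => ⟨_, represents_const c⟩

namespace WienerPlus

/-- The power series coefficients of `f ∈ A⁺(𝕋^k)`. -/
noncomputable def coeff {k : ℕ} (f : WienerPlus k) : (Fin k → ℕ) → ℂ := f.2.choose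

theorem represents_coeff {k : ℕ} (f : WienerPlus k) : Represents (coeff f) f.1 :=
  f.2.choose_spec

theorem coeff_eq {k : ℕ} {f : WienerPlus k} {a : (Fin k → ℕ) → ℂ} (ha : Represents a f.1) :
    coeff f = a :=
  (represents_coeff f).unique ha

/-- The norm of `A⁺(𝕋^k)`: the sum of the absolute values of the coefficients. -/
noncomputable def wienerNorm {k : ℕ} (f : WienerPlus k) : ℝ := ∑' n, ‖coeff f n‖

/-- An element of `A⁺(𝕋^k)` is determined by its values on the open polydisc. -/
theorem ext_polydisc {k : ℕ} {f g : WienerPlus k}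
    (h : ∀ z : polydisc k, f.1 (incl z) = g.1 (incl z)) : f = g :=
  Subtype.ext ((denseRange_incl k).equalizer (represents_coeff f).continuous
    (represents_coeff g).continuous (funext h))

/-- Composition with `φ : 𝔻^k → closed 𝔻^k` maps `A⁺(𝕋^k)` into itself: for every `f` in the algebra,
the function `f ∘ φ` on the open polydisc is (the restriction of) an element of the algebra. -/
def MapsIntoSelf {k : ℕ} (φ : polydisc k → closedPolydisc k) : Prop :=
  ∀ f : WienerPlus k, ∃ g : WienerPlus k, ∀ z, g.1 (incl z) = f.1 (φ z)

/-- The composition operator `C_φ f = f ∘ φ` on `A⁺(𝕋^k)`. -/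
noncomputable def compOp {k : ℕ} (φ : polydisc k → closedPolydisc k) (hφ : MapsIntoSelf φ) :
    WienerPlus k →ₐ[ℂ] WienerPlus k where
  toFun f := (hφ f).choose
  map_one' := ext_polydisc fun z => (hφ 1).choose_spec z
  map_mul' f g := ext_polydisc fun z => by
    have h1 := (hφ (f * g)).choose_spec z
    have h2 := (hφ f).choose_spec z
    have h3 := (hφ g).choose_spec z
    simp_all
  map_zero' := ext_polydisc fun z => (hφ 0).choose_spec z
  map_add' f g := ext_polydisc fun z => by
    have h1 := (hφ (f + g)).choose_spec z
    have h2 := (hφ f).choose_spec z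
    have h3 := (hφ g).choose_spec z
    simp_all
  commutes' c := ext_polydisc fun z => (hφ (algebraMap ℂ _ c)).choose_spec z

theorem compOp_apply {k : ℕ} (φ : polydisc k → closedPolydisc k) (hφ : MapsIntoSelf φ)
    (f : WienerPlus k) (z : polydisc k) : (compOp φ hφ f).1 (incl z) = f.1 (φ z) :=
  (hφ f).choose_spec z

/-- Boundedness of an operator on `A⁺(𝕋^k)` for the Wiener norm. -/
def IsBoundedOp {k : ℕ} (T : WienerPlus k →ₐ[ℂ] WienerPlus k) : Prop :=
  ∃ C : ℝ, ∀ f, wienerNorm (T f) ≤ C * wienerNorm f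

/-- `T` is an automorphism of the algebra `A⁺(𝕋^k)`. -/
def IsAutomorphism {k : ℕ} (T : WienerPlus k →ₐ[ℂ] WienerPlus k) : Prop :=
  ∃ e : WienerPlus k ≃ₐ[ℂ] WienerPlus k, (e : WienerPlus k →ₐ[ℂ] WienerPlus k) = T

end WienerPlus

/-! The converse direction only relabels coefficients and rotates them. For the direct one, write S
for `compOp φ hφ`, P_j = S(z_j) and Q_j = S⁻¹(z_j). Since 1 - c z_j is invertible in the algebra for
|c| < 1, all P_j and Q_j are bounded by 1. Put a_j = P_j(0); injectivity of S gives |a_j| < 1, so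
R_j = (P_j - a_j)/(1 - conj(a_j) P_j) lies in the algebra, is bounded by 1 and vanishes at 0. If τ
is the product of the inverse Möbius maps, then φ = τ ∘ R, and S(Q_i) = z_i reads (Q ∘ τ) ∘ R = id.
By Schwarz's lemma the derivatives of R and Q ∘ τ at 0 are contractions for the supremum norm, and
they are inverse to each other. Such a matrix is a permutation matrix up to unimodular factors
(`exists_perm_of_contractive_inverse`). So each R_j has a linear coefficient of modulus 1, Bessel's
inequality kills all the others, and R_j = ε_j z_{σ(j)}.

It remains to see that a_j = 0, and this is where boundedness is needed: the powers of z_j have norm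
1, so those of P_j have norm at most C. On the diagonal circle P_j becomes a unimodular Möbius
transform F. Pairing F^n with itself gives 1 ≤ C sup_m |m-th Fourier coefficient of F^n|. The fourth
power of every such coefficient is at most the mean over p of |∫ (F(x) F(p - x))^n dx|², a bound
free of m. By Wiener's lemma its Cesàro means in n tend to 0 as soon as, for almost every p, x ↦
F(x) F(p - x) has null level sets. If a_j ≠ 0, these level sets have at most two points for all p
but at most one, a contradiction. -/

open MeasureTheory Filter Topology ComplexConjugate

/-! ### Wiener's lemma for laws without atoms -/

/-- The Cesàro means of the powers of a unimodular number other than `1` tend to `0`. -/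
theorem tendsto_average_pow_of_norm_eq_one {v : ℂ} (hv : ‖v‖ = 1) (hv1 : v ≠ 1) :
    Tendsto (fun N : ℕ => (N : ℂ)⁻¹ * ∑ n ∈ Finset.range N, v ^ n) atTop (𝓝 0) := by
  have hlim : Tendsto (fun N : ℕ => ((N : ℝ))⁻¹ * (2 / ‖v - 1‖)) atTop (𝓝 0) := by
    simpa using (tendsto_inv_atTop_nhds_zero_nat (𝕜 := ℝ)).mul_const (2 / ‖v - 1‖)
  refine squeeze_zero_norm (fun N => ?_) hlim
  rw [geom_sum_eq hv1, norm_mul, norm_div, norm_inv, Complex.norm_natCast]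
  gcongr
  calc ‖v ^ N - 1‖ ≤ ‖v ^ N‖ + ‖(1 : ℂ)‖ := norm_sub_le _ _
    _ = 2 := by rw [norm_pow, hv, one_pow, norm_one]; norm_num

/-- Wiener's lemma: if a unimodular function has a law without atoms, then the squares of the
moduli of its moments tend to `0` in Cesàro mean. -/
theorem tendsto_average_sq_norm_integral_pow {X : Type*} [MeasurableSpace X] (μ : Measure X)
    [IsProbabilityMeasure μ] {u : X → ℂ} (hu : Measurable u) (hu1 : ∀ x, ‖u x‖ = 1)
    (hlevel : ∀ x, μ {z | u z = u x} = 0) :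
    Tendsto (fun N : ℕ => (N : ℝ)⁻¹ * ∑ n ∈ Finset.range N, ‖∫ x, u x ^ n ∂μ‖ ^ 2)
      atTop (𝓝 0) := by
  -- By Fubini the squared modulus of the n-th moment of `u` is the n-th moment of `w`. The Cesàro
  -- means of `w q ^ n` vanish in the limit off {w = 1}, whose sections are level sets of `u` and
  -- hence null.
  let w : X × X → ℂ := fun q => u q.1 * conj (u q.2)
  have hw : Measurable w :=
    (hu.comp measurable_fst).mul (Complex.continuous_conj.measurable.comp (hu.comp measurable_snd))
  have hw1 : ∀ q, ‖w q‖ = 1 := fun q => by simp [w, hu1]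
  have hmoment : ∀ n : ℕ, ((‖∫ x, u x ^ n ∂μ‖ ^ 2 : ℝ) : ℂ) = ∫ q, w q ^ n ∂(μ.prod μ) := by
    intro n
    have h := integral_prod_mul (μ := μ) (ν := μ) (fun x => u x ^ n) (fun x => conj (u x ^ n))
    rw [integral_conj, Complex.mul_conj, Complex.normSq_eq_norm_sq] at h
    rw [← h]
    exact integral_congr_ae (Eventually.of_forall fun q => by simp [w, mul_pow])
  have hint : ∀ n : ℕ, Integrable (fun q => w q ^ n) (μ.prod μ) := fun n =>
    Integrable.of_bound (hw.pow_const n).aestronglyMeasurable 1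
      (Eventually.of_forall fun q => by simp [hw1])
  have hne : ∀ᵐ q ∂(μ.prod μ), w q ≠ 1 := by
    have hms : MeasurableSet {q | w q ≠ 1} := (hw (measurableSet_singleton 1)).compl
    rw [Measure.ae_prod_iff_ae_ae hms]
    refine Eventually.of_forall fun x => ?_
    have hx : ∀ᵐ z ∂μ, ¬ u z = u x := by
      rw [ae_iff]
      simpa using hlevel x
    filter_upwards [hx] with z hz h1
    apply hz
    have hc : u z * conj (u z) = 1 := by
      rw [Complex.mul_conj, Complex.normSq_eq_norm_sq, hu1]
      simp
    calc u z = (u x * conj (u z)) * u z := by rw [show u x * conj (u z) = 1 from h1, one_mul]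
      _ = u x * (u z * conj (u z)) := by ring
      _ = u x := by rw [hc, mul_one]
  have hlim : Tendsto (fun N : ℕ => ∫ q, (N : ℂ)⁻¹ * ∑ n ∈ Finset.range N, w q ^ n ∂(μ.prod μ))
      atTop (𝓝 (∫ _, (0 : ℂ) ∂(μ.prod μ))) := by
    refine tendsto_integral_of_dominated_convergence (fun _ => 1) (fun N => ?_)
      (integrable_const _) (fun N => Eventually.of_forall fun q => ?_) ?_
    · exact ((Finset.measurable_sum _ fun n _ => hw.pow_const n).const_mul _).aestronglyMeasurable
    · rw [norm_mul, norm_inv, Complex.norm_natCast]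
      have : ‖∑ n ∈ Finset.range N, w q ^ n‖ ≤ N := by
        refine (norm_sum_le _ _).trans ?_
        simp [hw1]
      calc (N : ℝ)⁻¹ * ‖∑ n ∈ Finset.range N, w q ^ n‖ ≤ (N : ℝ)⁻¹ * N := by gcongr
        _ ≤ 1 := inv_mul_le_one
    · filter_upwards [hne] with q hq using tendsto_average_pow_of_norm_eq_one (hw1 q) hq
  rw [integral_zero] at hlim
  have heq : ∀ N : ℕ, ∫ q, (N : ℂ)⁻¹ * ∑ n ∈ Finset.range N, w q ^ n ∂(μ.prod μ) =
      (((N : ℝ)⁻¹ * ∑ n ∈ Finset.range N, ‖∫ x, u x ^ n ∂μ‖ ^ 2 : ℝ) : ℂ) := by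
    intro N
    rw [integral_const_mul, integral_finsetSum _ fun n _ => hint n]
    push_cast
    congr 1
    refine Finset.sum_congr rfl fun n _ => ?_
    rw [← hmoment n]
    push_cast
    rfl
  simp_rw [heq] at hlim
  simpa only [Function.comp_def, Complex.ofReal_re, Complex.zero_re] using
    (Complex.continuous_re.tendsto 0).comp hlim

/-! ### Powers of unimodular functions on the circle -/

instance UnitAddCircle.isProbabilityMeasure_volume :
    IsProbabilityMeasure (volume : Measure UnitAddCircle) :=
  ⟨UnitAddCircle.measure_univ⟩

theorem norm_fourier_apply (m : ℤ) (x : UnitAddCircle) : ‖fourier m x‖ = 1 := by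
  rw [fourier_apply]
  exact Circle.norm_coe _

/-- The fourth power of a mean is bounded by the mean square of the self-convolution. -/
theorem norm_integral_pow_four_le {h : UnitAddCircle → ℂ} (hh : Continuous h) :
    ‖∫ x, h x‖ ^ 4 ≤ ∫ p, ‖∫ x, h x * h (p - x)‖ ^ 2 := by
  let H : UnitAddCircle → ℂ := fun p => ∫ x, h x * h (p - x)
  have hc2 : Continuous (fun q : UnitAddCircle × UnitAddCircle => h q.2 * h (q.1 - q.2)) := by
    fun_prop
  have hH : Continuous H := by
    refine continuous_parametric_integral_of_continuous (μ := volume) (s := Set.univ)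
      (f := fun p x => h x * h (p - x)) hc2 isCompact_univ |>.congr fun p => by simp [H]
  -- The mean of a convolution is the product of the means. Bounding the mean of `‖H‖` by its mean
  -- square, through a nonnegative variance, supplies the second squaring.
  have hprod : (∫ x, h x) ^ 2 = ∫ p, H p := by
    have hswap : ∫ p, H p = ∫ x, ∫ p, h x * h (p - x) := by
      refine integral_integral_swap ?_
      exact hc2.integrable_of_hasCompactSupport (HasCompactSupport.of_compactSpace _)
    rw [hswap]
    simp_rw [integral_const_mul, integral_sub_right_eq_self h]
    rw [integral_mul_const, sq]
  have hi : ∀ {f : UnitAddCircle → ℝ}, Continuous f → Integrable f := fun hf =>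
    hf.integrable_of_hasCompactSupport (HasCompactSupport.of_compactSpace _)
  have h1 : ‖∫ x, h x‖ ^ 2 ≤ ∫ p, ‖H p‖ := by
    rw [← norm_pow, hprod]
    exact norm_integral_le_integral_norm _
  have h2 : (∫ p, ‖H p‖) ^ 2 ≤ ∫ p, ‖H p‖ ^ 2 := by
    set m := ∫ p, ‖H p‖ with hm
    have h3 : 0 ≤ ∫ p, (‖H p‖ - m) ^ 2 := integral_nonneg fun p => sq_nonneg _
    have h4 : ∫ p, (‖H p‖ - m) ^ 2 = (∫ p, ‖H p‖ ^ 2) - m ^ 2 := by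
      have h5 : ∀ p, (‖H p‖ - m) ^ 2 = ‖H p‖ ^ 2 - (2 * m) * ‖H p‖ + m ^ 2 := fun p => by ring
      simp_rw [h5]
      have i1 : Integrable fun p => ‖H p‖ ^ 2 := hi (by fun_prop)
      have i2 : Integrable fun p => 2 * m * ‖H p‖ := hi (by fun_prop)
      have i3 : Integrable fun p => ‖H p‖ ^ 2 - 2 * m * ‖H p‖ := i1.sub i2
      rw [integral_add i3 (integrable_const _), integral_sub i1 i2, integral_const_mul, ← hm]
      simp
      ring
    linarith
  calc ‖∫ x, h x‖ ^ 4 = (‖∫ x, h x‖ ^ 2) ^ 2 := by ring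
    _ ≤ (∫ p, ‖H p‖) ^ 2 := by gcongr
    _ ≤ ∫ p, ‖H p‖ ^ 2 := h2

/-- The Fourier coefficients of the powers of a unimodular function on the circle. -/
theorem norm_integral_pow_mul_fourier_pow_four_le {F : UnitAddCircle → ℂ} (hF : Continuous F)
    (n : ℕ) (m : ℤ) :
    ‖∫ x, F x ^ n * fourier m x‖ ^ 4 ≤ ∫ p, ‖∫ x, (F x * F (p - x)) ^ n‖ ^ 2 := by
  refine (norm_integral_pow_four_le (h := fun x => F x ^ n * fourier m x)
    (by fun_prop)).trans_eq ?_
  congr 1 with p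
  -- A character turns the convolution structure into the factor `fourier m p`, unimodular and
  -- constant in `x`; so the bound does not depend on `m`.
  have : ∀ x, F x ^ n * fourier m x * (F (p - x) ^ n * fourier m (p - x)) =
      fourier m p * (F x * F (p - x)) ^ n := fun x => by
    have h : (fourier m p : ℂ) = fourier m x * fourier m (p - x) := by
      simp only [fourier_apply]
      rw [← Circle.coe_mul, ← AddCircle.toCircle_add, ← smul_add, add_sub_cancel]
    rw [h]
    ring
  simp_rw [this]
  rw [integral_const_mul, norm_mul, norm_fourier_apply, one_mul]

/-- If `F` is a unimodular function on the circle such that for almost all `p` the function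
`x ↦ F x * F (p - x)` has null level sets, then the powers of `F` are not bounded in the Wiener
algebra. -/
theorem not_bounded_wiener_pow {F : UnitAddCircle → ℂ} (hF : Continuous F)
    (hF1 : ∀ x, ‖F x‖ = 1)
    (hlevel : ∀ᵐ p : UnitAddCircle, ∀ x, volume {z | F z * F (p - z) = F x * F (p - x)} = 0)
    {ι : Type*} [Countable ι] (e : ι → ℤ) (c : ℕ → ι → ℂ) (hc : ∀ n, Summable fun i => ‖c n i‖)
    (hsum : ∀ n x, HasSum (fun i => c n i * fourier (e i) x) (F x ^ n)) (C : ℝ) :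
    ¬ ∀ n, ∑' i, ‖c n i‖ ≤ C := by
  intro hC
  let J : ℕ → ℝ := fun n => ∫ p, ‖∫ x, (F x * F (p - x)) ^ n‖ ^ 2
  -- Expand 1 = ∫ F^n conj(F^n) with the series of the first factor: every term is `c n i` times a
  -- conjugated Fourier coefficient of F^n, of modulus at most s = J(n)^{1/4}. Hence 1 ≤ C s.
  have hJ : ∀ n, 1 ≤ C ^ 4 * J n := by
    intro n
    have hJ0 : 0 ≤ J n := integral_nonneg fun p => by positivity
    set s := (J n) ^ (1 / 4 : ℝ) with hs
    have hs0 : 0 ≤ s := by positivity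
    have hs4 : s ^ 4 = J n := by
      rw [hs, ← Real.rpow_natCast, ← Real.rpow_mul hJ0]
      norm_num
    have hterm : ∀ i, ∫ x, c n i * fourier (e i) x * conj (F x ^ n) =
        c n i * conj (∫ x, F x ^ n * fourier (- e i) x) := by
      intro i
      rw [← integral_conj, ← integral_const_mul]
      congr 1 with x
      rw [fourier_neg]
      simp
      ring
    have hb : ∀ i, ‖∫ x, c n i * fourier (e i) x * conj (F x ^ n)‖ ≤ ‖c n i‖ * s := by
      intro i
      rw [hterm, norm_mul, RCLike.norm_conj]
      gcongr
      refine le_of_pow_le_pow_left₀ (n := 4) (by norm_num) hs0 ?_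
      rw [hs4]
      exact norm_integral_pow_mul_fourier_pow_four_le hF n _
    have hS : HasSum (fun i => ∫ x, c n i * fourier (e i) x * conj (F x ^ n))
        (∫ x, ∑' i, c n i * fourier (e i) x * conj (F x ^ n)) := by
      refine hasSum_integral_of_summable_integral_norm (fun i => ?_) ?_
      · refine Continuous.integrable_of_hasCompactSupport ?_ (HasCompactSupport.of_compactSpace _)
        have := Complex.continuous_conj
        fun_prop
      · simp_rw [norm_mul, norm_fourier_apply, RCLike.norm_conj, norm_pow, hF1]
        simpa using hc n
    have hone : ∫ x, ∑' i, c n i * fourier (e i) x * conj (F x ^ n) = 1 := by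
      have : ∀ x, ∑' i, c n i * fourier (e i) x * conj (F x ^ n) = 1 := fun x => by
        rw [((hsum n x).mul_right _).tsum_eq, Complex.mul_conj, Complex.normSq_eq_norm_sq,
          norm_pow, hF1]
        simp
      simp_rw [this]
      simp
    have h1 : 1 ≤ (∑' i, ‖c n i‖) * s := by
      have h2 := tsum_of_norm_bounded ((hc n).hasSum.mul_right s) hb
      rwa [hS.tsum_eq, hone, norm_one] at h2
    have h2 : 1 ≤ C * s := h1.trans (by gcongr; exact hC n)
    calc (1 : ℝ) ≤ (C * s) ^ 4 := one_le_pow₀ h2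
      _ = C ^ 4 * J n := by rw [mul_pow, hs4]
  have hCpos : 0 < C ^ 4 := by
    by_contra h
    have h0 : C ^ 4 = 0 := le_antisymm (not_lt.1 h) (by positivity)
    have := hJ 0
    rw [h0, zero_mul] at this
    linarith
  have hKc : ∀ n : ℕ, Continuous fun p : UnitAddCircle => ∫ x, (F x * F (p - x)) ^ n := by
    intro n
    have hc2 : Continuous
        (fun q : UnitAddCircle × UnitAddCircle => (F q.2 * F (q.1 - q.2)) ^ n) := by fun_prop
    exact continuous_parametric_integral_of_continuous (μ := volume) (s := Set.univ)
      (f := fun p x => (F x * F (p - x)) ^ n) hc2 isCompact_univ |>.congr fun p => by simp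
  have hK1 : ∀ (n : ℕ) (p : UnitAddCircle), ‖∫ x, (F x * F (p - x)) ^ n‖ ^ 2 ≤ 1 := by
    intro n p
    refine pow_le_one₀ (norm_nonneg _) ?_
    refine (norm_integral_le_of_norm_le_const (C := 1)
      (Eventually.of_forall fun x => by simp [hF1])).trans (by simp)
  -- Wiener's lemma for almost every `p`, then dominated convergence: the Cesàro means of `J` tend
  -- to 0, against the lower bound `hJ`.
  have hlim : Tendsto (fun N : ℕ => ∫ p, (N : ℝ)⁻¹ * ∑ n ∈ Finset.range N,
      ‖∫ x, (F x * F (p - x)) ^ n‖ ^ 2) atTop (𝓝 (∫ _ : UnitAddCircle, (0 : ℝ))) := by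
    refine tendsto_integral_of_dominated_convergence (fun _ => 1) (fun N => ?_)
      (integrable_const _) (fun N => Eventually.of_forall fun p => ?_) ?_
    · refine Continuous.aestronglyMeasurable ?_
      exact continuous_const.mul (continuous_finsetSum _ fun n _ => ((hKc n).norm.pow 2))
    · have hsn : 0 ≤ ∑ n ∈ Finset.range N, ‖∫ x, (F x * F (p - x)) ^ n‖ ^ 2 := by positivity
      rw [Real.norm_of_nonneg (by positivity)]
      have : ∑ n ∈ Finset.range N, ‖∫ x, (F x * F (p - x)) ^ n‖ ^ 2 ≤ N := by
        refine (Finset.sum_le_sum fun n _ => hK1 n p).trans ?_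
        simp
      calc (N : ℝ)⁻¹ * ∑ n ∈ Finset.range N, ‖∫ x, (F x * F (p - x)) ^ n‖ ^ 2
          ≤ (N : ℝ)⁻¹ * N := by gcongr
        _ ≤ 1 := inv_mul_le_one
    · filter_upwards [hlevel] with p hp
      exact tendsto_average_sq_norm_integral_pow volume
        (by fun_prop : Continuous fun x => F x * F (p - x)).measurable
        (fun x => by simp [hF1]) hp
  rw [integral_zero] at hlim
  have hge : ∀ᶠ N : ℕ in atTop, (C ^ 4)⁻¹ ≤ ∫ p, (N : ℝ)⁻¹ * ∑ n ∈ Finset.range N,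
      ‖∫ x, (F x * F (p - x)) ^ n‖ ^ 2 := by
    filter_upwards [eventually_gt_atTop 0] with N hN
    have hi : ∀ n : ℕ, Integrable fun p => ‖∫ x, (F x * F (p - x)) ^ n‖ ^ 2 := fun n =>
      Continuous.integrable_of_hasCompactSupport ((hKc n).norm.pow 2)
        (HasCompactSupport.of_compactSpace _)
    rw [integral_const_mul, integral_finsetSum _ fun n _ => hi n]
    have hNpos : (0 : ℝ) < N := by exact_mod_cast hN
    rw [le_inv_mul_iff₀ hNpos]
    have : ∑ _n ∈ Finset.range N, (C ^ 4)⁻¹ ≤ ∑ n ∈ Finset.range N, J n :=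
      Finset.sum_le_sum fun n _ => by
        rw [inv_le_iff_one_le_mul₀ hCpos, mul_comm]
        exact hJ n
    simpa using this
  have := ge_of_tendsto hlim hge
  have : 0 < (C ^ 4)⁻¹ := by positivity
  linarith

/-! ### Disc automorphisms and their powers -/

theorem one_add_ne_zero_of_norm_lt_one {w : ℂ} (hw : ‖w‖ < 1) : 1 + w ≠ 0 := fun h => by
  rw [eq_neg_of_add_eq_zero_right h, norm_neg, norm_one] at hw
  exact lt_irrefl _ hw

/-- A disc automorphism maps the closed disc into itself. -/
theorem norm_sub_le_norm_one_sub_conj_mul {a w : ℂ} (ha : ‖a‖ ≤ 1) (hw : ‖w‖ ≤ 1) :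
    ‖w - a‖ ≤ ‖1 - conj a * w‖ := by
  have key : ‖1 - conj a * w‖ ^ 2 - ‖w - a‖ ^ 2 = (1 - ‖a‖ ^ 2) * (1 - ‖w‖ ^ 2) := by
    simp only [← Complex.normSq_eq_norm_sq, Complex.normSq_apply]
    simp
    ring
  have h1 : 0 ≤ 1 - ‖a‖ ^ 2 := by nlinarith [norm_nonneg a]
  have h2 : 0 ≤ 1 - ‖w‖ ^ 2 := by nlinarith [norm_nonneg w]
  refine le_of_sq_le_sq ?_ (norm_nonneg _)
  nlinarith [mul_nonneg h1 h2]

/-- A disc automorphism maps the open disc into itself. -/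
theorem norm_add_lt_norm_one_add_conj_mul {a w : ℂ} (ha : ‖a‖ < 1) (hw : ‖w‖ < 1) :
    ‖w + a‖ < ‖1 + conj a * w‖ := by
  have key : ‖1 + conj a * w‖ ^ 2 - ‖w + a‖ ^ 2 = (1 - ‖a‖ ^ 2) * (1 - ‖w‖ ^ 2) := by
    simp only [← Complex.normSq_eq_norm_sq, Complex.normSq_apply]
    simp
    ring
  have h1 : 0 < 1 - ‖a‖ ^ 2 := by nlinarith [norm_nonneg a]
  have h2 : 0 < 1 - ‖w‖ ^ 2 := by nlinarith [norm_nonneg w]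
  refine lt_of_pow_lt_pow_left₀ 2 (norm_nonneg _) ?_
  nlinarith [mul_pos h1 h2]

/-- A disc automorphism maps the unit circle into itself. -/
theorem norm_add_eq_norm_one_add_conj_mul {a w : ℂ} (hw : ‖w‖ = 1) :
    ‖w + a‖ = ‖1 + conj a * w‖ := by
  have key : ‖1 + conj a * w‖ ^ 2 - ‖w + a‖ ^ 2 = (1 - ‖a‖ ^ 2) * (1 - ‖w‖ ^ 2) := by
    simp only [← Complex.normSq_eq_norm_sq, Complex.normSq_apply]
    simp
    ring
  rw [hw] at key
  rw [← sq_eq_sq₀ (norm_nonneg _) (norm_nonneg _)]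
  linarith

/-- For a disc automorphism `f`, the product `f(w₁) f(w₂)` with `w₁ w₂` prescribed and generic
determines the pair `{w₁, w₂}`. -/
theorem mobius_mul_mobius_injective {a q w₁ w₂ v₁ v₂ : ℂ} (ha : ‖a‖ < 1) (hw : w₁ * w₂ = q)
    (hv : v₁ * v₂ = q) (hq : conj a * q ≠ a)
    (hw₁ : 1 + conj a * w₁ ≠ 0) (hw₂ : 1 + conj a * w₂ ≠ 0)
    (hv₁ : 1 + conj a * v₁ ≠ 0) (hv₂ : 1 + conj a * v₂ ≠ 0)
    (h : (v₁ + a) / (1 + conj a * v₁) * ((v₂ + a) / (1 + conj a * v₂)) =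
      (w₁ + a) / (1 + conj a * w₁) * ((w₂ + a) / (1 + conj a * w₂))) :
    v₁ = w₁ ∨ v₁ = w₂ := by
  rw [div_mul_div_comm, div_mul_div_comm, div_eq_div_iff (mul_ne_zero hv₁ hv₂)
    (mul_ne_zero hw₁ hw₂)] at h
  have hna : 1 - a * conj a ≠ 0 := by
    rw [sub_eq_add_neg]
    refine one_add_ne_zero_of_norm_lt_one ?_
    rw [norm_neg, norm_mul, RCLike.norm_conj]
    nlinarith [norm_nonneg a]
  -- With s = w₁ + w₂, the product of the two values is (q + a s + a²)/(1 + conj(a) s + conj(a)² q),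
  -- a homography in s of determinant (a - conj(a) q)(1 - |a|²). It is injective when this is
  -- nonzero, and sum and product determine the pair.
  have hprod : (a - conj a * q) * (1 - a * conj a) * ((v₁ + v₂) - (w₁ + w₂)) = 0 := by
    linear_combination h
      - ((1 + conj a * w₁) * (1 + conj a * w₂) - conj a ^ 2 * ((w₁ + a) * (w₂ + a))) * hv
      - (conj a ^ 2 * (q + a * (v₁ + v₂) + a ^ 2) - (1 + conj a * (v₁ + v₂) + conj a ^ 2 * q)) * hw
  have hs : (v₁ + v₂) - (w₁ + w₂) = 0 := by
    rcases mul_eq_zero.1 hprod with h1 | h1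
    · rcases mul_eq_zero.1 h1 with h2 | h2
      · exact absurd (sub_eq_zero.1 h2).symm hq
      · exact absurd h2 hna
    · exact h1
  have : (v₁ - w₁) * (v₁ - w₂) = 0 := by linear_combination v₁ * hs + hw - hv
  rcases mul_eq_zero.1 this with h1 | h1
  · exact Or.inl (sub_eq_zero.1 h1)
  · exact Or.inr (sub_eq_zero.1 h1)

instance UnitAddCircle.nullSingletonClass_volume :
    NullSingletonClass (volume : Measure UnitAddCircle) where
  measure_singleton x := by
    rw [← Metric.closedBall_zero, AddCircle.volume_closedBall]
    simp

theorem toCircle_coe_injective :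
    Function.Injective fun x : UnitAddCircle => (AddCircle.toCircle x : ℂ) :=
  Subtype.val_injective.comp (AddCircle.injective_toCircle one_ne_zero)

/-- If the powers of a disc automorphism are bounded in the Wiener algebra of the circle, then this
automorphism is a rotation. -/
theorem eq_zero_of_bounded_wiener_mobius_pow {a ε : ℂ} (ha : ‖a‖ < 1) (hε : ‖ε‖ = 1)
    {ι : Type*} [Countable ι] (e : ι → ℤ) (c : ℕ → ι → ℂ) (hc : ∀ n, Summable fun i => ‖c n i‖)
    (hsum : ∀ (n : ℕ) (x : UnitAddCircle), HasSum (fun i => c n i * fourier (e i) x)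
      (((ε * AddCircle.toCircle x + a) / (1 + conj a * (ε * AddCircle.toCircle x))) ^ n))
    (C : ℝ) (hC : ∀ n, ∑' i, ‖c n i‖ ≤ C) : a = 0 := by
  by_contra ha0
  let w : UnitAddCircle → ℂ := fun x => ε * AddCircle.toCircle x
  have hw1 : ∀ x, ‖w x‖ = 1 := fun x => by simp only [w, norm_mul, hε, Circle.norm_coe, one_mul]
  have hwc : Continuous w :=
    continuous_const.mul (continuous_subtype_val.comp AddCircle.continuous_toCircle)
  have hden : ∀ x, 1 + conj a * w x ≠ 0 := fun x => one_add_ne_zero_of_norm_lt_one (by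
    rw [norm_mul, hw1, mul_one, RCLike.norm_conj]
    exact ha)
  have hε0 : ε ≠ 0 := fun h => by simp [h] at hε
  have hwinj : Function.Injective w := fun x y h =>
    toCircle_coe_injective (mul_left_cancel₀ hε0 h)
  have hwmul : ∀ p x, w x * w (p - x) = ε * w p := by
    intro p x
    have : (AddCircle.toCircle p : ℂ) = AddCircle.toCircle x * AddCircle.toCircle (p - x) := by
      rw [← Circle.coe_mul, ← AddCircle.toCircle_add, add_sub_cancel]
    simp only [w, this]
    ring
  refine not_bounded_wiener_pow (F := fun x => (w x + a) / (1 + conj a * w x)) ?_ ?_ ?_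
    e c hc hsum C hC
  · exact (hwc.add continuous_const).div (by fun_prop) hden
  · intro x
    rw [norm_div, norm_add_eq_norm_one_add_conj_mul (hw1 x), div_self]
    exact norm_ne_zero_iff.2 (hden x)
  -- The product w(x) w(p - x) is ε w(p), so genericity excludes at most one `p`, by injectivity of
  -- `w`. For the others a level set is contained in {x, p - x}.
  · have hgen : ∀ᵐ p : UnitAddCircle, conj a * (ε * w p) ≠ a := by
      rw [ae_iff]
      refine Set.Subsingleton.measure_zero (fun p hp p' hp' => ?_) _
      have h1 : conj a * (ε * w p) = a := not_not.1 hp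
      have h2 : conj a * (ε * w p') = a := not_not.1 hp'
      exact hwinj (mul_left_cancel₀ hε0 (mul_left_cancel₀ (by simpa using ha0)
        (h1.trans h2.symm)))
    filter_upwards [hgen] with p hp x
    refine measure_mono_null (t := {x} ∪ {p - x}) (fun z hz => ?_) ?_
    · rcases mobius_mul_mobius_injective ha (hwmul p x) (hwmul p z) hp (hden x) (hden _) (hden z)
        (hden _) hz with h | h
      · exact Or.inl (hwinj h)
      · exact Or.inr (hwinj h)
    · exact measure_union_null (measure_singleton _) (measure_singleton _)

/-! ### Bessel's inequality and the coordinate functions -/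

namespace WienerPlus

variable {k : ℕ}

/-- Bessel's inequality for functions bounded by `1` in the Wiener algebra. -/
theorem Represents.sum_sq_norm_le_one {a : (Fin k → ℕ) → ℂ} {f : closedPolydisc k → ℂ}
    (ha : Represents a f) (hf : ∀ z, ‖f z‖ ≤ 1) (s : Finset (Fin k → ℕ)) :
    ∑ n ∈ s, ‖a n‖ ^ 2 ≤ 1 := by
  let ι : (Fin k → ℕ) → (Fin k → ℤ) := fun n i => n i
  have hι : Function.Injective ι := fun n m h => by
    funext i
    exact Int.ofNat_injective (congrFun h i)
  let E : (Fin k → ℕ) → C(UnitAddTorus (Fin k), ℂ) := fun n => UnitAddTorus.mFourier (ι n)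
  have hS : Summable (fun n => a n • E n) := by
    refine Summable.of_norm ?_
    simpa [norm_smul, E, UnitAddTorus.mFourier_norm] using ha.1
  let G : C(UnitAddTorus (Fin k), ℂ) := ∑' n, a n • E n
  have hG : ‖G‖ ≤ 1 := by
    refine (ContinuousMap.norm_le _ zero_le_one).2 fun x => ?_
    let z : closedPolydisc k := ⟨fun i => (AddCircle.toCircle (x i) : ℂ),
      fun i => (Circle.norm_coe _).le⟩
    have hGz : G x = f z := by
      rw [← ContinuousMap.tsum_apply hS x, ← (ha.2 z).tsum_eq]
      refine tsum_congr fun n => ?_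
      simp [E, ι, z, monomial, UnitAddTorus.mFourier, fourier_apply, AddCircle.toCircle_nsmul]
    rw [hGz]
    exact hf z
  let _ : MeasureSpace UnitAddCircle := ⟨AddCircle.haarAddCircle⟩
  have : IsProbabilityMeasure (volume : Measure UnitAddCircle) :=
    inferInstanceAs (IsProbabilityMeasure AddCircle.haarAddCircle)
  let Φ : C(UnitAddTorus (Fin k), ℂ) →L[ℂ] Lp ℂ 2 (volume : Measure (UnitAddTorus (Fin k))) :=
    ContinuousMap.toLp (E := ℂ) 2 volume ℂ
  have hΦ : ‖Φ G‖ ≤ 1 := by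
    have h1 : ‖Φ‖ ≤ 1 := by
      have := ContinuousMap.toLp_norm_le (p := 2) (E := ℂ) (𝕜 := ℂ)
        (μ := (volume : Measure (UnitAddTorus (Fin k))))
      simpa [measureUnivNNReal] using this
    calc ‖Φ G‖ ≤ ‖Φ‖ * ‖G‖ := Φ.le_opNorm G
      _ ≤ 1 * 1 := by gcongr
      _ = 1 := one_mul 1
  have hv : Orthonormal ℂ fun n : Fin k → ℕ =>
      (UnitAddTorus.mFourierLp 2 (ι n) : Lp ℂ 2 (volume : Measure (UnitAddTorus (Fin k)))) :=
    (UnitAddTorus.orthonormal_mFourier (d := Fin k)).comp ι hι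
  have hcoef : ∀ m, inner ℂ (UnitAddTorus.mFourierLp 2 (ι m) : Lp ℂ 2 _) (Φ G) = a m := by
    intro m
    let L : C(UnitAddTorus (Fin k), ℂ) →L[ℂ] ℂ :=
      (innerSL ℂ (UnitAddTorus.mFourierLp 2 (ι m))).comp Φ
    have hL : ∀ n, L (E n) = if m = n then 1 else 0 := fun n => by
      have ho := orthonormal_iff_ite.1 hv m n
      exact ho
    have h2 := ContinuousLinearMap.hasSum L hS.hasSum
    simp only [map_smul, hL] at h2
    have h3 := hasSum_single m (f := fun n => a n • (if m = n then (1 : ℂ) else 0))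
      (fun n hn => by simp [Ne.symm hn])
    have h4 := h2.unique h3
    simp only [if_true, smul_eq_mul, mul_one] at h4
    exact h4
  have hB := hv.sum_inner_products_le (s := s) (Φ G)
  simp only [hcoef] at hB
  refine hB.trans ?_
  exact pow_le_one₀ (norm_nonneg _) hΦ

/-- A function bounded by `1` with a coefficient of modulus at least `1` is a monomial. -/
theorem Represents.eq_monomial_of_one_le_norm {a : (Fin k → ℕ) → ℂ} {f : closedPolydisc k → ℂ}
    (ha : Represents a f) (hf : ∀ z, ‖f z‖ ≤ 1) {m : Fin k → ℕ} (hm : 1 ≤ ‖a m‖)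
    (z : closedPolydisc k) : f z = a m * monomial m z := by
  refine (ha.2 z).unique (hasSum_single m fun n hn => ?_)
  -- The coefficient at `m` already exhausts the total mass 1, leaving nothing for `n`.
  have h := ha.sum_sq_norm_le_one hf {m, n}
  rw [Finset.sum_pair hn.symm] at h
  have h0 : ‖a n‖ = 0 := by
    by_contra h0
    have : 0 < ‖a n‖ ^ 2 := by positivity
    nlinarith
  rw [norm_eq_zero.1 h0, zero_mul]

theorem monomial_single (i : Fin k) (m : ℕ) (z : closedPolydisc k) :
    monomial (Pi.single i m) z = z.1 i ^ m := by
  rw [monomial, Finset.prod_eq_single i]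
  · simp
  · intro j _ hj
    simp [hj]
  · simp

theorem single_injective (i : Fin k) :
    Function.Injective (fun m : ℕ => (Pi.single i m : Fin k → ℕ)) :=
  Pi.single_injective (M := fun _ : Fin k => ℕ) i

/-- A power series in one of the coordinates. -/
theorem represents_single (i : Fin k) {b : ℕ → ℂ} (hb : Summable fun m => ‖b m‖)
    {f : closedPolydisc k → ℂ} (hf : ∀ z, HasSum (fun m => b m * z.1 i ^ m) (f z)) :
    Represents (Function.extend (fun m : ℕ => (Pi.single i m : Fin k → ℕ)) b 0) f := by
  constructor
  · have h := (single_injective i).summable_iff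
      (f := fun n => ‖Function.extend (fun m : ℕ => (Pi.single i m : Fin k → ℕ)) b 0 n‖)
      (fun n hn => by
        rw [Function.extend_apply' _ _ _ (by simpa using hn)]
        simp)
    refine h.1 ?_
    simpa only [Function.comp_def, (single_injective i).extend_apply] using hb
  · intro z
    have h := (single_injective i).hasSum_iff
      (f := fun n => Function.extend (fun m : ℕ => (Pi.single i m : Fin k → ℕ)) b 0 n *
        monomial n z) (a := f z) (fun n hn => by
        rw [Function.extend_apply' _ _ _ (by simpa using hn)]
        simp)
    refine h.1 ?_
    simpa only [Function.comp_def, (single_injective i).extend_apply, monomial_single] using hf z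

/-- The coordinate functions. -/
def coord (i : Fin k) : WienerPlus k :=
  ⟨fun z => z.1 i, _, represents_single i (b := fun m => if m = 1 then 1 else 0)
    (summable_of_ne_finset_zero (s := {1}) fun m hm => by simp [Finset.notMem_singleton.1 hm])
    fun z => by
      have h := hasSum_single (f := fun m => (if m = 1 then (1 : ℂ) else 0) * z.1 i ^ m) 1
        (fun m hm => by simp [hm])
      simpa using h⟩

@[simp]
theorem coord_apply (i : Fin k) (z : closedPolydisc k) : (coord i).1 z = z.1 i := rfl

/-- The inverse is the geometric series, whose coefficients are absolutely summable. It gives both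
the bound on images of coordinates and the Möbius transforms inside the algebra. -/
theorem isUnit_one_sub_smul_coord (i : Fin k) {c : ℂ} (hc : ‖c‖ < 1) :
    IsUnit (1 - c • coord i : WienerPlus k) := by
  have hlt : ∀ z : closedPolydisc k, ‖c * z.1 i‖ < 1 := fun z => by
    rw [norm_mul]
    nlinarith [norm_nonneg c, norm_nonneg (z.1 i), z.2 i]
  have hrep : Represents (Function.extend (fun m : ℕ => (Pi.single i m : Fin k → ℕ)) (fun m => c ^ m) 0)
      (fun z : closedPolydisc k => (1 - c * z.1 i)⁻¹) := by
    refine represents_single i ?_ fun z => ?_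
    · simpa using summable_geometric_of_norm_lt_one (x := ‖c‖) (by simpa using hc)
    · simpa only [mul_pow] using hasSum_geometric_of_norm_lt_one (hlt z)
  refine IsUnit.of_mul_eq_one ⟨_, _, hrep⟩ (Subtype.ext (funext fun z => ?_))
  have hne : 1 - c * z.1 i ≠ 0 := fun h => by
    have h1 := hlt z
    rw [← sub_eq_zero.1 h, norm_one] at h1
    exact lt_irrefl _ h1
  exact mul_inv_cancel₀ hne

theorem apply_ne_zero_of_isUnit {f : WienerPlus k} (hf : IsUnit f) (z : closedPolydisc k) :
    f.1 z ≠ 0 := by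
  obtain ⟨g, hg⟩ := hf.exists_right_inv
  intro h
  have := congrFun (congrArg Subtype.val hg) z
  simp [h] at this

/-- The image of a coordinate function under an endomorphism of the algebra is bounded by `1`. -/
theorem norm_algHom_coord_le (S : WienerPlus k →ₐ[ℂ] WienerPlus k) (i : Fin k)
    (z : closedPolydisc k) : ‖(S (coord i)).1 z‖ ≤ 1 := by
  by_contra! h
  -- With c the inverse of the offending value, 1 - c z_i is a unit, yet its image under `S`
  -- vanishes at `z`.
  have hc : ‖((S (coord i)).1 z)⁻¹‖ < 1 := by
    rw [norm_inv]
    exact inv_lt_one_of_one_lt₀ h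
  have hne : (S (coord i)).1 z ≠ 0 := fun h0 => by
    rw [h0, norm_zero] at h
    linarith
  refine apply_ne_zero_of_isUnit ((isUnit_one_sub_smul_coord i hc).map S) z ?_
  simp [hne]

/-! ### Holomorphy in the open polydisc and derivatives at the origin -/

/-- The sum of the power series of `f`, as a function on `ℂ^k`. -/
noncomputable def extension (f : WienerPlus k) (w : Fin k → ℂ) : ℂ :=
  ∑' n, coeff f n * ∏ i, w i ^ n i

theorem extension_eq (f : WienerPlus k) (z : closedPolydisc k) : extension f z.1 = f.1 z :=
  ((represents_coeff f).2 z).tsum_eq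

theorem mem_ball_iff_mem_polydisc {w : Fin k → ℂ} :
    w ∈ Metric.ball (0 : Fin k → ℂ) 1 ↔ w ∈ polydisc k := by
  rw [mem_ball_zero_iff, pi_norm_lt_iff one_pos]
  rfl

/-- Cauchy's estimate on the ball of radius 1 - r about `w`, where the monomial moves by at most 2.
Uniformity in `n` is what allows termwise differentiation of the series. -/
theorem norm_fderiv_prod_pow_le (n : Fin k → ℕ) {r : ℝ} (hr : r < 1) {w : Fin k → ℂ}
    (hw : w ∈ Metric.ball (0 : Fin k → ℂ) r) :
    ‖fderiv ℂ (fun v : Fin k → ℂ => ∏ i, v i ^ n i) w‖ ≤ 2 / (1 - r) := by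
  have hb : ∀ v ∈ Metric.ball (0 : Fin k → ℂ) 1, ‖∏ i, v i ^ n i‖ ≤ 1 := fun v hv =>
    norm_monomial_le n (incl ⟨v, mem_ball_iff_mem_polydisc.1 hv⟩)
  have hsub : Metric.ball w (1 - r) ⊆ Metric.ball (0 : Fin k → ℂ) 1 := by
    refine Metric.ball_subset_ball' ?_
    rw [Metric.mem_ball] at hw
    linarith
  have hd : Differentiable ℂ (fun v : Fin k → ℂ => ∏ i, v i ^ n i) := fun v => by fun_prop
  refine Complex.norm_fderiv_le_div_of_mapsTo_ball hd.differentiableOn (fun v hv => ?_) (by linarith)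
  rw [mem_closedBall_iff_norm]
  have h1 := hb v (hsub hv)
  have h2 := hb w (hsub (Metric.mem_ball_self (by linarith)))
  linarith [norm_sub_le (∏ i, v i ^ n i) (∏ i, w i ^ n i)]

theorem hasFDerivAt_extension (f : WienerPlus k) {w : Fin k → ℂ}
    (hw : w ∈ Metric.ball (0 : Fin k → ℂ) 1) :
    HasFDerivAt (extension f)
      (∑' n, coeff f n • fderiv ℂ (fun v : Fin k → ℂ => ∏ i, v i ^ n i) w) w := by
  obtain ⟨r, hwr, hr⟩ := exists_between (mem_ball_zero_iff.1 hw)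
  have hw' : w ∈ Metric.ball (0 : Fin k → ℂ) r := mem_ball_zero_iff.2 hwr
  have hz : Summable fun n => coeff f n * ∏ i, w i ^ n i :=
    ((represents_coeff f).2 (incl ⟨w, mem_ball_iff_mem_polydisc.1 hw⟩)).summable
  refine hasFDerivAt_tsum_of_isPreconnected (u := fun n => ‖coeff f n‖ * (2 / (1 - r)))
    (f' := fun n v => coeff f n • fderiv ℂ (fun v : Fin k → ℂ => ∏ i, v i ^ n i) v)
    ((represents_coeff f).1.mul_right _) Metric.isOpen_ball
    (convex_ball (0 : Fin k → ℂ) r).isPreconnected (fun n v _ => ?_) (fun n v hv => ?_) hw' hz hw'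
  · have hd : DifferentiableAt ℂ (fun v : Fin k → ℂ => ∏ i, v i ^ n i) v := by fun_prop
    exact hd.hasFDerivAt.const_mul (coeff f n)
  · rw [norm_smul]
    gcongr
    exact norm_fderiv_prod_pow_le n hr hv

theorem differentiableOn_extension (f : WienerPlus k) :
    DifferentiableOn ℂ (extension f) (Metric.ball 0 1) := fun _ hw =>
  (hasFDerivAt_extension f hw).differentiableAt.differentiableWithinAt

theorem fderiv_prod_pow_zero (n : Fin k → ℕ) (i : Fin k) :
    fderiv ℂ (fun v : Fin k → ℂ => ∏ j, v j ^ n j) 0 (Pi.single i 1) =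
      if n = Pi.single i 1 then 1 else 0 := by
  have hd : DifferentiableAt ℂ (fun v : Fin k → ℂ => ∏ j, v j ^ n j) 0 := by fun_prop
  have h := hd.hasFDerivAt.hasLineDerivAt (Pi.single i 1)
  refine h.unique ?_
  unfold HasLineDerivAt
  -- Along the i-th axis a monomial involving another coordinate vanishes identically; any other
  -- monomial is t^(n i).
  by_cases hn : ∃ j, j ≠ i ∧ n j ≠ 0
  · obtain ⟨j, hji, hnj⟩ := hn
    have hne : n ≠ Pi.single i 1 := fun h => hnj (by rw [h]; simp [hji])
    rw [if_neg hne]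
    refine (hasDerivAt_const (0 : ℂ) (0 : ℂ)).congr_of_eventuallyEq
      (Eventually.of_forall fun t => ?_)
    refine Finset.prod_eq_zero (Finset.mem_univ j) ?_
    simp [hji, hnj]
  · push Not at hn
    have hn' : n = Pi.single i (n i) := by
      funext j
      by_cases hj : j = i
      · subst hj; simp
      · simp [hj, hn j hj]
    have hfun : (fun t : ℂ => ∏ j, ((0 : Fin k → ℂ) + t • (Pi.single i 1 : Fin k → ℂ)) j ^ n j) =
        fun t => t ^ n i := by
      funext t
      rw [Finset.prod_eq_single i]
      · simp
      · intro j _ hj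
        simp [hn j hj]
      · simp
    rw [hfun]
    have hp := hasDerivAt_pow (n i) (0 : ℂ)
    suffices hval : (if n = Pi.single i 1 then (1 : ℂ) else 0) = n i * 0 ^ (n i - 1) by
      rw [hval]
      exact hp
    by_cases h1 : n i = 1
    · rw [h1] at hn'
      rw [if_pos hn', h1]
      simp
    · have hne : n ≠ Pi.single i 1 := fun h => h1 (by rw [h]; simp)
      rw [if_neg hne]
      rcases Nat.eq_zero_or_pos (n i) with h0 | h0
      · simp [h0]
      · rw [zero_pow (by omega), mul_zero]

/-- Turns information on the derivative at 0 into information on linear coefficients, to which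
Bessel's inequality applies. -/
theorem fderiv_extension_zero (f : WienerPlus k) (i : Fin k) :
    fderiv ℂ (extension f) 0 (Pi.single i 1) = coeff f (Pi.single i 1) := by
  have h0 : (0 : Fin k → ℂ) ∈ Metric.ball (0 : Fin k → ℂ) (1 / 2) :=
    Metric.mem_ball_self (by norm_num)
  rw [(hasFDerivAt_extension f (Metric.mem_ball_self one_pos)).fderiv]
  have hs : Summable fun n : Fin k → ℕ =>
      coeff f n • fderiv ℂ (fun v : Fin k → ℂ => ∏ i, v i ^ n i) 0 := by
    refine Summable.of_norm_bounded ((represents_coeff f).1.mul_right (2 / (1 - 1 / 2)))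
      fun n => ?_
    rw [norm_smul]
    gcongr
    exact norm_fderiv_prod_pow_le n (by norm_num) h0
  have h1 := (ContinuousLinearMap.apply ℂ ℂ (Pi.single i 1 : Fin k → ℂ)).hasSum hs.hasSum
  refine h1.unique ?_
  have h2 := hasSum_single (Pi.single i 1) (f := fun n : Fin k → ℕ =>
    coeff f n * (if n = Pi.single i 1 then (1 : ℂ) else 0)) (fun n hn => by simp [hn])
  simpa [fderiv_prod_pow_zero] using h2

end WienerPlus

/-! ### Contractions for the supremum norm -/

/-- The rows of a contraction for the supremum norm have absolute sum at most `1`. -/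
theorem sum_norm_apply_single_le_one {ι : Type*} [Fintype ι] [DecidableEq ι]
    {A : (ι → ℂ) →L[ℂ] (ι → ℂ)} (hA : ‖A‖ ≤ 1) (j : ι) :
    ∑ i, ‖A (Pi.single i 1) j‖ ≤ 1 := by
  -- The test vector aligns the phases of row `j`, so that its image has j-th entry the absolute row
  -- sum.
  have hphase : ∀ c : ℂ, ∃ u : ℂ, ‖u‖ ≤ 1 ∧ u * c = ‖c‖ := by
    intro c
    by_cases hc : c = 0
    · exact ⟨0, by simp, by simp [hc]⟩
    · have hn : (‖c‖ : ℂ) ≠ 0 := by exact_mod_cast norm_ne_zero_iff.2 hc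
      refine ⟨‖c‖ / c, ?_, div_mul_cancel₀ _ hc⟩
      rw [norm_div, Complex.norm_real, norm_norm]
      exact div_self_le_one _
  choose u hu1 hu using fun i => hphase (A (Pi.single i 1) j)
  have h1 : A u j = ((∑ i, ‖A (Pi.single i 1) j‖ : ℝ) : ℂ) := by
    have : u = ∑ i, u i • (Pi.single i 1 : ι → ℂ) := by
      simp [← Pi.single_smul, Finset.univ_sum_single]
    conv_lhs => rw [this]
    simp [hu]
  have h2 : ‖A u j‖ ≤ 1 := calc
    ‖A u j‖ ≤ ‖A u‖ := norm_le_pi_norm _ j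
    _ ≤ ‖A‖ * ‖u‖ := A.le_opNorm u
    _ ≤ 1 * 1 := by
      gcongr
      exact (pi_norm_le_iff_of_nonneg zero_le_one).2 hu1
    _ = 1 := one_mul 1
  rw [h1, Complex.norm_real, Real.norm_of_nonneg (by positivity)] at h2
  exact h2

/-- A contraction for the supremum norm with a contractive inverse is a permutation of the
coordinates up to unimodular factors. -/
theorem exists_perm_of_contractive_inverse {ι : Type*} [Fintype ι] [DecidableEq ι]
    {A B : (ι → ℂ) →L[ℂ] (ι → ℂ)} (hA : ‖A‖ ≤ 1) (hB : ‖B‖ ≤ 1)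
    (hBA : B.comp A = ContinuousLinearMap.id ℂ _) :
    ∃ σ : Equiv.Perm ι, ∀ j, 1 ≤ ‖A (Pi.single (σ j) 1) j‖ := by
  have hAB : ∀ x, A (B x) = x := by
    have h1 : (B : (ι → ℂ) →ₗ[ℂ] (ι → ℂ)) * (A : (ι → ℂ) →ₗ[ℂ] (ι → ℂ)) = 1 :=
      LinearMap.ext fun x => by simpa using congrArg (fun L => L x) hBA
    have h2 := mul_eq_one_comm.1 h1
    intro x
    simpa using LinearMap.congr_fun h2 x
  have hBA' : ∀ x, B (A x) = x := fun x => by simpa using congrArg (fun L => L x) hBA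
  have hexp : ∀ (L : (ι → ℂ) →L[ℂ] (ι → ℂ)) (x : ι → ℂ) (j : ι),
      L x j = ∑ i, x i * L (Pi.single i 1) j := by
    intro L x j
    have : x = ∑ i, x i • (Pi.single i 1 : ι → ℂ) := by
      simp [← Pi.single_smul, Finset.univ_sum_single]
    conv_lhs => rw [this]
    simp
  have hB1 : ∀ i j, ‖B (Pi.single j 1) i‖ ≤ 1 := fun i j =>
    (Finset.single_le_sum (f := fun j => ‖B (Pi.single j 1) i‖) (fun _ _ => norm_nonneg _)
      (Finset.mem_univ j)).trans (sum_norm_apply_single_le_one hB i)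
  -- The (j, j) entry of AB is 1. If column `j` of `B` had only entries of modulus below 1, this sum
  -- would be strictly smaller than the absolute sum of row `j` of `A`, which is at most 1.
  have hex : ∀ j, ∃ i, 1 ≤ ‖B (Pi.single j 1) i‖ := by
    intro j
    by_contra! hlt
    have h1 : (1 : ℂ) = ∑ i, B (Pi.single j 1) i * A (Pi.single i 1) j := by
      rw [← hexp, hAB]
      simp
    have h2 : (1 : ℝ) ≤ ∑ i, ‖B (Pi.single j 1) i‖ * ‖A (Pi.single i 1) j‖ := by
      calc (1 : ℝ) = ‖(1 : ℂ)‖ := norm_one.symm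
        _ ≤ ∑ i, ‖B (Pi.single j 1) i * A (Pi.single i 1) j‖ :=
          (congrArg norm h1).trans_le (norm_sum_le _ _)
        _ = _ := by simp only [norm_mul]
    have hne : ∃ i, A (Pi.single i 1) j ≠ 0 := by
      by_contra! h0
      simp [h0] at h1
    obtain ⟨i₀, hi₀⟩ := hne
    have h3 : ∑ i, ‖B (Pi.single j 1) i‖ * ‖A (Pi.single i 1) j‖ <
        ∑ i, ‖A (Pi.single i 1) j‖ := by
      refine Finset.sum_lt_sum (fun i _ => mul_le_of_le_one_left (norm_nonneg _) (hB1 i j))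
        ⟨i₀, Finset.mem_univ _, ?_⟩
      exact mul_lt_of_lt_one_left (norm_pos_iff.2 hi₀) (hlt i₀)
    linarith [sum_norm_apply_single_le_one hA j]
  choose σ hσ using hex
  -- Row σ(j) of `B` has absolute sum at most 1, already attained in column `j`. Hence σ is
  -- injective, and the diagonal entry of BA at σ(j) reduces to one product, equal to 1.
  have hrow : ∀ j l, l ≠ j → B (Pi.single l 1) (σ j) = 0 := by
    intro j l hl
    have h1 : ‖B (Pi.single l 1) (σ j)‖ + ‖B (Pi.single j 1) (σ j)‖ ≤ 1 := by
      have h2 := Finset.sum_le_sum_of_subset_of_nonneg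
        (f := fun m => ‖B (Pi.single m 1) (σ j)‖) (Finset.subset_univ {l, j})
        (fun _ _ _ => norm_nonneg _)
      rw [Finset.sum_pair hl] at h2
      exact h2.trans (sum_norm_apply_single_le_one hB (σ j))
    have h3 : ‖B (Pi.single l 1) (σ j)‖ ≤ 0 := by linarith [hσ j]
    exact norm_le_zero_iff.1 h3
  have hinj : Function.Injective σ := by
    intro j l hjl
    by_contra hne
    have h1 := hrow l j hne
    rw [← hjl] at h1
    have h2 := hσ j
    rw [h1, norm_zero] at h2
    linarith
  refine ⟨Equiv.ofBijective σ (Finite.injective_iff_bijective.1 hinj), fun j => ?_⟩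
  have h1 : (1 : ℂ) = A (Pi.single (σ j) 1) j * B (Pi.single j 1) (σ j) := by
    have h2 := hexp B (A (Pi.single (σ j) 1)) (σ j)
    rw [hBA', Finset.sum_eq_single j (fun l _ hl => by rw [hrow j l hl, mul_zero])
      (by simp)] at h2
    simpa using h2
  have h2 : (1 : ℝ) = ‖A (Pi.single (σ j) 1) j‖ * ‖B (Pi.single j 1) (σ j)‖ := by
    rw [← norm_mul, ← h1, norm_one]
  change 1 ≤ ‖A (Pi.single (σ j) 1) j‖
  rw [h2]
  exact mul_le_of_le_one_right (norm_nonneg _) (hB1 _ _)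

/-! ### From automorphisms to permutations and rotations -/

namespace WienerPlus

variable {k : ℕ}

theorem coeff_zero (f : WienerPlus k) :
    coeff f 0 = f.1 (incl ⟨0, fun i => by simp⟩) := by
  refine HasSum.unique ?_ ((represents_coeff f).2 _)
  have h := hasSum_single (0 : Fin k → ℕ)
    (f := fun n => coeff f n * monomial n (incl ⟨(0 : Fin k → ℂ), fun i => by simp⟩))
    (fun n hn => by
      obtain ⟨i, hi⟩ := Function.ne_iff.1 hn
      have : monomial n (incl ⟨(0 : Fin k → ℂ), fun i => by simp⟩) = 0 :=
        Finset.prod_eq_zero (Finset.mem_univ i) (by simpa [incl] using hi)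
      rw [this, mul_zero])
  simpa [monomial] using h

theorem coeff_coord_pow (i : Fin k) (n : ℕ) :
    coeff (coord i ^ n) = Function.extend (fun m : ℕ => (Pi.single i m : Fin k → ℕ))
      (fun m => if m = n then 1 else 0) 0 := by
  refine coeff_eq (represents_single i ?_ fun z => ?_)
  · exact summable_of_ne_finset_zero (s := {n}) fun m hm => by
      simp [Finset.notMem_singleton.1 hm]
  · have h := hasSum_single (f := fun m => (if m = n then (1 : ℂ) else 0) * z.1 i ^ m) n
      (fun m hm => by simp [hm])
    simpa using h

theorem wienerNorm_coord_pow (i : Fin k) (n : ℕ) : wienerNorm (coord i ^ n) = 1 := by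
  rw [wienerNorm, coeff_coord_pow, tsum_eq_single (Pi.single i n)]
  · rw [(single_injective i).extend_apply]
    simp
  · intro m hm
    by_cases h : ∃ l : ℕ, (Pi.single i l : Fin k → ℕ) = m
    · obtain ⟨l, rfl⟩ := h
      rw [(single_injective i).extend_apply, if_neg (fun h => hm (by rw [h])), norm_zero]
    · rw [Function.extend_apply' _ _ _ h]
      simp

/-- The Möbius transform of a coordinate function belongs to the Wiener algebra. -/
theorem exists_mobius_coord (i : Fin k) {a : ℂ} (ha : ‖a‖ < 1) :
    ∃ M : WienerPlus k, M * (1 - conj a • coord i) = coord i - algebraMap ℂ _ a := by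
  obtain ⟨g, hg⟩ := (isUnit_one_sub_smul_coord i (c := conj a) (by simpa using ha)).exists_left_inv
  exact ⟨(coord i - algebraMap ℂ _ a) * g, by rw [mul_assoc, hg, mul_one]⟩

/-- An injective endomorphism maps no coordinate function to a function of modulus `1` at `0`. -/
theorem norm_algHom_coord_zero_lt_one {S : WienerPlus k →ₐ[ℂ] WienerPlus k}
    (hS : Function.Injective S) (i : Fin k) :
    ‖(S (coord i)).1 (incl ⟨0, fun i => by simp⟩)‖ < 1 := by
  by_contra! h
  rw [← coeff_zero] at h
  -- Otherwise the constant coefficient has modulus at least 1, so the image is constant; by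
  -- injectivity the coordinate itself would be constant.
  have hconst : S (coord i) = S (algebraMap ℂ _ (coeff (S (coord i)) 0)) := by
    rw [AlgHom.commutes]
    refine Subtype.ext (funext fun z => ?_)
    rw [(represents_coeff (S (coord i))).eq_monomial_of_one_le_norm
      (norm_algHom_coord_le S i) h z]
    simp [monomial]
  have h1 := congrArg Subtype.val (hS hconst)
  have h2 := congrFun h1 ⟨0, fun i => by simp⟩
  have h3 := congrFun h1 ⟨1, fun i => by simp⟩
  exact zero_ne_one (α := ℂ) (h2.trans h3.symm)

/-- An element whose powers are bounded in the Wiener algebra and which is a disc automorphism of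
one of the coordinates is a rotation of this coordinate. -/
theorem eq_zero_of_bounded_mobius_pow {P : WienerPlus k} {a ε : ℂ} {l : Fin k} (ha : ‖a‖ < 1)
    (hε : ‖ε‖ = 1) (hP : ∀ z, P.1 z = (ε * z.1 l + a) / (1 + conj a * (ε * z.1 l)))
    {C : ℝ} (hC : ∀ n : ℕ, wienerNorm (P ^ n) ≤ C) : a = 0 := by
  refine eq_zero_of_bounded_wiener_mobius_pow ha hε
    -- On the diagonal circle the monomial of exponent `n` is the character of its total degree.
    -- Different exponents may share a degree, so the series is not grouped by frequency.
    (fun n : Fin k → ℕ => ((∑ i, n i : ℕ) : ℤ)) (fun n => coeff (P ^ n))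
    (fun n => (represents_coeff _).1) (fun n x => ?_) C hC
  let z : closedPolydisc k := ⟨fun _ => (AddCircle.toCircle x : ℂ),
    fun _ => (Circle.norm_coe _).le⟩
  have h := (represents_coeff (P ^ n)).2 z
  have hz : (P ^ n).1 z =
      ((ε * AddCircle.toCircle x + a) / (1 + conj a * (ε * AddCircle.toCircle x))) ^ n := by
    rw [← hP z]
    rfl
  rw [hz] at h
  convert h using 2 with m
  congr 1
  rw [monomial, Finset.prod_pow_eq_pow_sum, fourier_apply, natCast_zsmul,
    AddCircle.toCircle_nsmul, Circle.coe_pow]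

/-- If `R` and `Q` are systems of elements of the Wiener algebra bounded by `1`, with `R(0) = 0`,
and `Q` composed with a product of disc automorphisms inverts `R` on the open polydisc, then `R` is
a permutation of the coordinates up to unimodular factors. -/
theorem exists_perm_eq_mul_coord {R Q : Fin k → WienerPlus k} {a : Fin k → ℂ}
    (ha : ∀ j, ‖a j‖ < 1) (hR : ∀ j z, ‖(R j).1 z‖ ≤ 1) (hQ : ∀ j z, ‖(Q j).1 z‖ ≤ 1)
    (hR0 : ∀ j, extension (R j) 0 = 0)
    (hQR : ∀ z ∈ Metric.ball (0 : Fin k → ℂ) 1, ∀ i, extension (Q i)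
      (fun j => (extension (R j) z + a j) / (1 + conj (a j) * extension (R j) z)) = z i) :
    ∃ (σ : Equiv.Perm (Fin k)) (ε : Fin k → ℂ), (∀ j, ‖ε j‖ = 1) ∧
      ∀ j z, (R j).1 z = ε j * z.1 (σ j) := by
  let r : (Fin k → ℂ) → (Fin k → ℂ) := fun z j => extension (R j) z
  let τ : (Fin k → ℂ) → (Fin k → ℂ) := fun w j => (w j + a j) / (1 + conj (a j) * w j)
  let q : (Fin k → ℂ) → (Fin k → ℂ) := fun w i => extension (Q i) (τ w)
  have hbd : ∀ {f : WienerPlus k}, (∀ z, ‖f.1 z‖ ≤ 1) →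
      ∀ w ∈ Metric.ball (0 : Fin k → ℂ) 1, ‖extension f w‖ ≤ 1 := by
    intro f hf w hw
    have h := hf (incl ⟨w, mem_ball_iff_mem_polydisc.1 hw⟩)
    rwa [← extension_eq] at h
  have hcoord : ∀ w ∈ Metric.ball (0 : Fin k → ℂ) 1, ∀ j, ‖w j‖ < 1 := fun w hw =>
    mem_ball_iff_mem_polydisc.1 hw
  have hden : ∀ w ∈ Metric.ball (0 : Fin k → ℂ) 1, ∀ j, 1 + conj (a j) * w j ≠ 0 := by
    intro w hw j
    refine one_add_ne_zero_of_norm_lt_one ?_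
    rw [norm_mul, RCLike.norm_conj]
    nlinarith [ha j, hcoord w hw j, norm_nonneg (a j), norm_nonneg (w j)]
  have hτmaps : Set.MapsTo τ (Metric.ball 0 1) (Metric.ball 0 1) := by
    intro w hw
    refine mem_ball_iff_mem_polydisc.2 fun j => ?_
    change ‖(w j + a j) / (1 + conj (a j) * w j)‖ < 1
    rw [norm_div, div_lt_one (norm_pos_iff.2 (hden w hw j))]
    exact norm_add_lt_norm_one_add_conj_mul (ha j) (hcoord w hw j)
  have hτd : DifferentiableOn ℂ τ (Metric.ball 0 1) := by
    refine differentiableOn_pi.2 fun j w hw => DifferentiableAt.differentiableWithinAt ?_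
    have h1 : DifferentiableAt ℂ (fun w : Fin k → ℂ => w j + a j) w := by fun_prop
    have h2 : DifferentiableAt ℂ (fun w : Fin k → ℂ => 1 + conj (a j) * w j) w := by fun_prop
    have h3 := h1.mul (h2.inv (hden w hw j))
    simp only [τ, div_eq_mul_inv]
    exact h3
  have hrd : DifferentiableOn ℂ r (Metric.ball 0 1) :=
    differentiableOn_pi.2 fun j => differentiableOn_extension (R j)
  have hqd : DifferentiableOn ℂ q (Metric.ball 0 1) :=
    differentiableOn_pi.2 fun i => (differentiableOn_extension (Q i)).comp hτd hτmaps
  have hr0 : r 0 = 0 := funext hR0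
  have h0 : (0 : Fin k → ℂ) ∈ Metric.ball (0 : Fin k → ℂ) 1 := Metric.mem_ball_self one_pos
  have hnhds : Metric.ball (0 : Fin k → ℂ) 1 ∈ 𝓝 (0 : Fin k → ℂ) := Metric.ball_mem_nhds _ one_pos
  have hqr : ∀ z ∈ Metric.ball (0 : Fin k → ℂ) 1, q (r z) = z := fun z hz => funext (hQR z hz)
  have hq0 : q 0 = 0 := by
    have := hqr 0 h0
    rwa [hr0] at this
  have hr' : DifferentiableAt ℂ r 0 := hrd.differentiableAt hnhds
  have hq' : DifferentiableAt ℂ q (r 0) := by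
    rw [hr0]
    exact hqd.differentiableAt hnhds
  -- Schwarz's lemma: the unit ball of the supremum norm is the polydisc, and `r` maps it into the
  -- closed ball while fixing 0. The same holds for `q`.
  have hA : ‖fderiv ℂ r 0‖ ≤ 1 := by
    have := Complex.norm_fderiv_le_div_of_mapsTo_ball (R₂ := 1) hrd (fun z hz => by
      rw [hr0, mem_closedBall_zero_iff, pi_norm_le_iff_of_nonneg zero_le_one]
      exact fun j => hbd (hR j) z hz) one_pos
    simpa using this
  have hB : ‖fderiv ℂ q 0‖ ≤ 1 := by
    have := Complex.norm_fderiv_le_div_of_mapsTo_ball (R₂ := 1) hqd (fun z hz => by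
      rw [hq0, mem_closedBall_zero_iff, pi_norm_le_iff_of_nonneg zero_le_one]
      exact fun i => hbd (hQ i) _ (hτmaps hz)) one_pos
    simpa using this
  have hBA : (fderiv ℂ q 0).comp (fderiv ℂ r 0) = ContinuousLinearMap.id ℂ _ := by
    have h1 := fderiv_comp (𝕜 := ℂ) 0 hq' hr'
    rw [hr0] at h1
    rw [← h1, ← fderiv_id (𝕜 := ℂ) (x := (0 : Fin k → ℂ))]
    refine Filter.EventuallyEq.fderiv_eq ?_
    filter_upwards [hnhds] with z hz using hqr z hz
  obtain ⟨σ, hσ⟩ := exists_perm_of_contractive_inverse hA hB hBA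
  have hcoeff : ∀ j i, fderiv ℂ r 0 (Pi.single i 1) j = coeff (R j) (Pi.single i 1) := by
    intro j i
    rw [← fderiv_extension_zero]
    have h1 := hasFDerivAt_pi'.1 hr'.hasFDerivAt j
    rw [h1.fderiv]
    rfl
  have hone : ∀ j, 1 ≤ ‖coeff (R j) (Pi.single (σ j) 1)‖ := fun j => by
    rw [← hcoeff]
    exact hσ j
  refine ⟨σ, fun j => coeff (R j) (Pi.single (σ j) 1), fun j => le_antisymm ?_ (hone j),
    fun j z => ?_⟩
  · have h1 := (represents_coeff (R j)).sum_sq_norm_le_one (hR j) {Pi.single (σ j) 1}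
    rw [Finset.sum_singleton] at h1
    exact (sq_le_one_iff₀ (norm_nonneg _)).1 h1
  · rw [(represents_coeff (R j)).eq_monomial_of_one_le_norm (hR j) (hone j) z, monomial_single,
      pow_one]

/-- A composition automorphism is given by a permutation and rotations of the coordinates. -/
theorem exists_perm_of_isAutomorphism {φ : polydisc k → closedPolydisc k} {hφ : MapsIntoSelf φ}
    (hbdd : IsBoundedOp (compOp φ hφ)) (haut : IsAutomorphism (compOp φ hφ)) :
    ∃ (σ : Equiv.Perm (Fin k)) (ε : Fin k → ℂ), (∀ j, ‖ε j‖ = 1) ∧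
      ∀ (z : polydisc k) (j : Fin k), (φ z).1 j = ε j * z.1 (σ j) := by
  obtain ⟨e, he⟩ := haut
  obtain ⟨C, hC⟩ := hbdd
  set S := compOp φ hφ with hS
  have heS : ∀ f, e f = S f := fun f => by rw [← he]; rfl
  have hinj : Function.Injective S := fun f g h => e.injective (by rw [heS, heS, h])
  let o : polydisc k := ⟨0, fun i => by simp⟩
  let P : Fin k → WienerPlus k := fun j => S (coord j)
  let Q : Fin k → WienerPlus k := fun j => e.symm (coord j)
  have hSQ : ∀ j, S (Q j) = coord j := fun j => by rw [← heS]; exact e.apply_symm_apply _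
  have hP : ∀ j z, (P j).1 (incl z) = (φ z).1 j := fun j z => compOp_apply φ hφ (coord j) z
  let a : Fin k → ℂ := fun j => (P j).1 (incl o)
  have ha : ∀ j, ‖a j‖ < 1 := fun j => norm_algHom_coord_zero_lt_one hinj j
  choose M hM using fun j => exists_mobius_coord j (ha j)
  -- As `S` is an algebra homomorphism, R_j is the Möbius transform of P_j that sends a_j to 0.
  let R : Fin k → WienerPlus k := fun j => S (M j)
  have hRP : ∀ j z, (R j).1 z * (1 - conj (a j) * (P j).1 z) = (P j).1 z - a j := by
    intro j z
    have h1 := congrArg S (hM j)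
    rw [map_mul, map_sub, map_sub, map_one, map_smul, AlgHom.commutes] at h1
    exact congrFun (congrArg Subtype.val h1) z
  have hP1 : ∀ j z, ‖(P j).1 z‖ ≤ 1 := fun j z => norm_algHom_coord_le S j z
  have hden : ∀ j z, 1 - conj (a j) * (P j).1 z ≠ 0 := by
    intro j z
    rw [sub_eq_add_neg]
    refine one_add_ne_zero_of_norm_lt_one ?_
    rw [norm_neg, norm_mul, RCLike.norm_conj]
    nlinarith [ha j, hP1 j z, norm_nonneg (a j), norm_nonneg ((P j).1 z)]
  have hR1 : ∀ j z, ‖(R j).1 z‖ ≤ 1 := by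
    intro j z
    have h1 := congrArg norm (hRP j z)
    rw [norm_mul] at h1
    have h2 := norm_sub_le_norm_one_sub_conj_mul (ha j).le (hP1 j z)
    have h3 := norm_pos_iff.2 (hden j z)
    by_contra! h4
    nlinarith
  have hden' : ∀ j z, 1 + conj (a j) * (R j).1 z ≠ 0 := by
    intro j z
    refine one_add_ne_zero_of_norm_lt_one ?_
    rw [norm_mul, RCLike.norm_conj]
    nlinarith [ha j, hR1 j z, norm_nonneg (a j), norm_nonneg ((R j).1 z)]
  have hPR : ∀ j z, (P j).1 z = ((R j).1 z + a j) / (1 + conj (a j) * (R j).1 z) := by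
    intro j z
    rw [eq_div_iff (hden' j z)]
    linear_combination -hRP j z
  have hext : ∀ (f : WienerPlus k) (z : polydisc k), extension f z.1 = f.1 (incl z) :=
    fun f z => extension_eq f (incl z)
  have hR0 : ∀ j, extension (R j) 0 = 0 := by
    intro j
    rw [show (0 : Fin k → ℂ) = o.1 from rfl, hext]
    have h1 := hRP j (incl o)
    rw [show (P j).1 (incl o) - a j = 0 from sub_self _] at h1
    exact (mul_eq_zero.1 h1).resolve_right (hden j _)
  obtain ⟨σ, ε, hε, hRε⟩ := exists_perm_eq_mul_coord ha hR1
    (fun j z => norm_algHom_coord_le (e.symm : WienerPlus k →ₐ[ℂ] WienerPlus k) j z) hR0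
    (fun z hz i => by
      let z' : polydisc k := ⟨z, mem_ball_iff_mem_polydisc.1 hz⟩
      -- The inverse Möbius maps recover φ(z) from R(z), and Q_i(φ(z)) = S(Q_i)(z) = z_i.
      have h1 : (fun j => (extension (R j) z + a j) / (1 + conj (a j) * extension (R j) z)) =
          (φ z').1 := by
        funext j
        rw [show z = z'.1 from rfl, hext, ← hPR, hP]
      rw [h1, extension_eq]
      change (Q i).1 (φ z') = _
      rw [← compOp_apply φ hφ, ← hS, hSQ]
      rfl)
  -- The only use of boundedness: powers of a coordinate have norm exactly 1.
  have hC' : ∀ j (n : ℕ), wienerNorm (P j ^ n) ≤ C := by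
    intro j n
    have h1 := hC (coord j ^ n)
    rwa [wienerNorm_coord_pow, mul_one, map_pow] at h1
  have ha0 : ∀ j, a j = 0 := fun j =>
    eq_zero_of_bounded_mobius_pow (l := σ j) (ha j) (hε j)
      (fun z => by rw [hPR, hRε]) (hC' j)
  refine ⟨σ, ε, hε, fun z j => ?_⟩
  rw [← hP, hPR, hRε, ha0]
  simp [incl]

/-! ### From permutations and rotations to automorphisms -/

/-- Rotations and permutations of the coordinates act on the Wiener algebra. -/
theorem exists_comp_perm (σ : Equiv.Perm (Fin k)) {ε : Fin k → ℂ} (hε : ∀ j, ‖ε j‖ = 1)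
    (g : WienerPlus k) : ∃ f : WienerPlus k, ∀ z w : closedPolydisc k,
      (∀ j, z.1 (σ j) = ε j * w.1 j) → f.1 w = g.1 z := by
  -- Moving the coordinates by σ moves the exponents by `ρ`, and the rotations multiply each
  -- coefficient by a unimodular number, so absolute summability survives.
  let ρ : Equiv.Perm (Fin k → ℕ) := Equiv.arrowCongr σ (Equiv.refl ℕ)
  have hρ : ∀ n j, ρ n (σ j) = n j := fun n j => by simp [ρ, Equiv.arrowCongr]
  have hz : ∀ w : closedPolydisc k, ∃ z : closedPolydisc k, ∀ j, z.1 (σ j) = ε j * w.1 j :=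
    fun w => ⟨⟨fun i => ε (σ.symm i) * w.1 (σ.symm i), fun i => by
      rw [norm_mul, hε, one_mul]
      exact w.2 _⟩, fun j => by simp⟩
  choose ζ hζ using hz
  have hmon : ∀ n w, monomial (ρ n) (ζ w) = (∏ j, ε j ^ n j) * monomial n w := by
    intro n w
    rw [monomial, monomial, ← Equiv.prod_comp σ, ← Finset.prod_mul_distrib]
    exact Finset.prod_congr rfl fun j _ => by rw [hρ, hζ, mul_pow]
  have hrep : Represents (fun n => coeff g (ρ n) * ∏ j, ε j ^ n j) (fun w => g.1 (ζ w)) := by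
    constructor
    · have h1 := (Equiv.summable_iff ρ).2 (represents_coeff g).1
      simpa [norm_prod, hε, Function.comp_def] using h1
    · intro w
      have h1 := (Equiv.hasSum_iff ρ).2 ((represents_coeff g).2 (ζ w))
      simpa only [Function.comp_def, hmon, mul_assoc] using h1
  refine ⟨⟨_, _, hrep⟩, fun z w hzw => ?_⟩
  have : ζ w = z := Subtype.ext (funext fun i => by
    obtain ⟨j, rfl⟩ := σ.surjective i
    rw [hζ, hzw])
  change g.1 (ζ w) = g.1 z
  rw [this]

/-- Composition with a permutation and rotations of the coordinates is an automorphism. -/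
theorem isAutomorphism_of_perm {φ : polydisc k → closedPolydisc k} {hφ : MapsIntoSelf φ}
    (σ : Equiv.Perm (Fin k)) {ε : Fin k → ℂ} (hε : ∀ j, ‖ε j‖ = 1)
    (h : ∀ (z : polydisc k) (j : Fin k), (φ z).1 j = ε j * z.1 (σ j)) :
    IsAutomorphism (compOp φ hφ) := by
  have hε0 : ∀ j, ε j ≠ 0 := fun j => norm_ne_zero_iff.1 (by rw [hε]; exact one_ne_zero)
  have hinj : Function.Injective (compOp φ hφ) := by
    intro f g hfg
    refine ext_polydisc fun w => ?_
    -- The preimage of `w` under φ: since φ covers the open polydisc, f ∘ φ determines f.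
    let z : polydisc k := ⟨fun i => (ε (σ.symm i))⁻¹ * w.1 (σ.symm i), fun i => by
      rw [norm_mul, norm_inv, hε, inv_one, one_mul]
      exact w.2 _⟩
    have hz : φ z = incl w := Subtype.ext (funext fun j => by
      rw [h]
      simp [z, incl, hε0 j])
    rw [← hz, ← compOp_apply φ hφ, ← compOp_apply φ hφ, hfg]
  have hsurj : Function.Surjective (compOp φ hφ) := by
    intro g
    obtain ⟨f, hf⟩ := exists_comp_perm σ (ε := fun j => (ε j)⁻¹)
      (fun j => by rw [norm_inv, hε, inv_one]) g
    refine ⟨f, ext_polydisc fun z => ?_⟩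
    rw [compOp_apply]
    refine hf _ _ fun j => ?_
    rw [h, inv_mul_cancel_left₀ (hε0 j)]
    rfl
  exact ⟨AlgEquiv.ofBijective _ ⟨hinj, hsurj⟩, AlgHom.ext fun f => rfl⟩

end WienerPlus

theorem theorem3p3 (k : ℕ) (φ : polydisc k → closedPolydisc k)
    (hφ : WienerPlus.MapsIntoSelf φ)
    (hbdd : WienerPlus.IsBoundedOp (WienerPlus.compOp φ hφ)) :
    WienerPlus.IsAutomorphism (WienerPlus.compOp φ hφ) ↔
      ∃ (σ : Equiv.Perm (Fin k)) (ε : Fin k → ℂ), (∀ j, ‖ε j‖ = 1) ∧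
        ∀ (z : polydisc k) (j : Fin k), (φ z).1 j = ε j * z.1 (σ j) :=
  ⟨WienerPlus.exists_perm_of_isAutomorphism hbdd,
    fun ⟨σ, _, hε, h⟩ => WienerPlus.isAutomorphism_of_perm σ hε h⟩
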